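/- Let $L=(L_t)_{t\ge 0}$ be a real-valued Lévy process on a probability space (measurable, a.s. right-continuous paths with left limits, $L_0=0$ a.s., stochastically continuous, stationary and independent increments) that is not constant, i.e. it is not the case that $L_t=0$ a.s. for all $t\ge 0$. Let $\eta\colon\mathbb R\to\mathbb C$ be its characteristic exponent, that is, the function determined by $\mathbb E[e^{iuL_t}]=e^{t\eta(u)}$ for all $t\ge 0$, $u\in\mathbb R$. Let $C_0(\mathbb R)$ be the space of continuous functions $f\colon\mathbb R\to\mathbb R$ vanishing at infinity, with the sup-norm. Let $\mathcal A^*$ be the infinitesimal generator on $C_0(\mathbb R)$ of the dual process $-L$: a function $f\in C_0(\mathbb R)$ belongs to $D(\mathcal A^*)$ with $\mathcal A^*f=h\in C_0(\mathbb R)$ if and only if $$\lim_{t\downarrow 0}\ \sup_{x\in\mathbb R}\Big|\frac{\mathbb E[f(x-L_t)]-f(x)}{t}-h(x)\Big|=0 .$$ For $g\in L^1(\mathbb R)$ write $\hat g(\xi)=\int_{\mathbb R}e^{i\xi x}g(x)\,dx$. Proposition. Suppose that $g\in C_0(\mathbb R)\cap L^1(\mathbb R)$, that $\xi\mapsto \hat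 g(\xi)/\eta(\xi)$ is locally bounded at zero (there are $\varepsilon>0$ and $C$ such that $|\hat g(\xi)/\eta(\xi)|\le C$ for $0<|\xi|<\varepsilon$), and that $H\in D(\mathcal A^*)\subset C_0(\mathbb R)$ is a solution of the Poisson equation $\mathcal A^*H=g$ with $H\ge 0$. Then $H\in L^1(\mathbb R)$. -/

import Mathlib

open MeasureTheory ProbabilityTheory Filter Topology Set
open scoped NNReal ZeroAtInfty

/-- A real-valued Lévy process `L = (L_t)_{t ≥ 0}` under the probability measure `P`: almost surely
right-continuous paths with left limits, almost surely issued from `0`, stochastically continuous,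
with stationary and independent increments. -/
structure IsLevyProcess {Ω : Type*} [MeasurableSpace Ω] (L : ℝ≥0 → Ω → ℝ) (P : Measure Ω) :
    Prop where
  measurable : ∀ t, Measurable (L t)
  rcll : ∀ᵐ ω ∂P, ∀ t : ℝ≥0, ContinuousWithinAt (fun s => L s ω) (Ici t) t ∧
    ∃ l : ℝ, Tendsto (fun s => L s ω) (𝓝[<] t) (𝓝 l)
  start_zero : ∀ᵐ ω ∂P, L 0 ω = 0
  stoch_cont : ∀ t : ℝ≥0, TendstoInMeasure P L (𝓝 t) (L t)
  stationary : ∀ s t : ℝ≥0,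
    P.map (fun ω => L (s + t) ω - L s ω) = P.map (fun ω => L t ω - L 0 ω)
  indep : HasIndepIncrements L P

/-- The characteristic exponent `η` of a Lévy process `L`: `η u` is the unique complex number with
`E[exp (i u L_t)] = exp (t η(u))` for all `t ≥ 0`. Existence and uniqueness are
`IsLevyProcess.charFun_eq` and `charExponent_eq` below; by uniqueness `η` is the function given by
the Lévy-Khintchine formula. -/
noncomputable def charExponent {Ω : Type*} [MeasurableSpace Ω] (L : ℝ≥0 → Ω → ℝ) (P : Measure Ω)
    (u : ℝ) : ℂ :=
  Classical.epsilon fun z : ℂ => ∀ t : ℝ≥0,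
    charFun (P.map (L t)) u = Complex.exp (((t : ℝ) : ℂ) * z)

theorem exp_mul_injective {z w : ℂ}
    (h : ∀ t : ℝ≥0, Complex.exp (((t : ℝ) : ℂ) * z) = Complex.exp (((t : ℝ) : ℂ) * w)) :
    z = w := by
  have key : ∀ v : ℂ, HasDerivWithinAt (fun t : ℝ => Complex.exp ((t : ℂ) * v)) v (Ici 0) 0 := by
    intro v
    have h1 : HasDerivAt (fun t : ℝ => (t : ℂ) * v) (1 * v) 0 :=
      (HasDerivAt.ofReal_comp (hasDerivAt_id (0 : ℝ))).mul_const v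
    have h2 := h1.cexp
    simpa using h2.hasDerivWithinAt
  have hz := (key z).congr (f₁ := fun t : ℝ => Complex.exp ((t : ℂ) * w))
    (fun t ht => (h ⟨t, ht⟩).symm) (by simp)
  exact (uniqueDiffOn_Ici (0 : ℝ) 0 self_mem_Ici).eq_deriv _ hz (key w)

theorem charExponent_eq {Ω : Type*} [MeasurableSpace Ω] {L : ℝ≥0 → Ω → ℝ} {P : Measure Ω}
    {u : ℝ} {z : ℂ}
    (hz : ∀ t : ℝ≥0, charFun (P.map (L t)) u = Complex.exp (((t : ℝ) : ℂ) * z)) :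
    charExponent L P u = z := by
  have h := Classical.epsilon_spec (p := fun z : ℂ => ∀ t : ℝ≥0,
    charFun (P.map (L t)) u = Complex.exp (((t : ℝ) : ℂ) * z)) ⟨z, hz⟩
  exact exp_mul_injective fun t => (h t).symm.trans (hz t)

/-- A continuous multiplicative function on `[0, ∞)` is an exponential. -/
theorem exists_exp_of_mul {f : ℝ → ℂ} (hf : Continuous f) (h0 : f 0 = 1)
    (hmul : ∀ s t, 0 ≤ s → 0 ≤ t → f (s + t) = f s * f t) :
    ∃ z : ℂ, ∀ t, 0 ≤ t → f t = Complex.exp ((t : ℂ) * z) := by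
  let F : ℝ → ℂ := fun x => ∫ s in (0 : ℝ)..x, f s
  have hF : ∀ x, HasDerivAt F (f x) x := fun x =>
    intervalIntegral.integral_hasDerivAt_right (hf.intervalIntegrable _ _)
      (hf.stronglyMeasurableAtFilter _ _) hf.continuousAt
  have hF0 : F 0 = 0 := intervalIntegral.integral_same
  obtain ⟨δ, hδ, hFδ⟩ : ∃ δ, 0 < δ ∧ F δ ≠ 0 := by
    have h1 : ∀ᶠ x in 𝓝[≠] (0 : ℝ), F x ≠ 0 :=
      (hF 0).eventually_ne (by rw [h0]; exact one_ne_zero)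
    have h2 : ∀ᶠ x in 𝓝[>] (0 : ℝ), F x ≠ 0 :=
      h1.filter_mono (nhdsWithin_mono _ fun x hx => ne_of_gt hx)
    obtain ⟨x, hx1, hx2⟩ := (h2.and self_mem_nhdsWithin).exists
    exact ⟨x, hx2, hx1⟩
  have hrep : ∀ t, 0 ≤ t → f t = (F (t + δ) - F t) / F δ := by
    intro t ht
    rw [eq_div_iff hFδ]
    have h1 : F (t + δ) - F t = ∫ s in t..(t + δ), f s :=
      intervalIntegral.integral_interval_sub_left (hf.intervalIntegrable _ _)
        (hf.intervalIntegrable _ _)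
    have h2 : ∫ s in t..(t + δ), f s = ∫ s in (0 : ℝ)..δ, f (t + s) := by
      rw [intervalIntegral.integral_comp_add_left (fun s => f s) t, add_zero]
    rw [h1, h2, ← intervalIntegral.integral_const_mul]
    refine intervalIntegral.integral_congr fun s hs => ?_
    rw [uIcc_of_le hδ.le] at hs
    exact (hmul t s ht hs.1).symm
  let z : ℂ := (f δ - 1) / F δ
  have hder : ∀ t, 0 ≤ t → HasDerivWithinAt f (f t * z) (Ici t) t := by
    intro t ht
    have h1 : HasDerivAt (fun x => (F (x + δ) - F x) / F δ) ((f (t + δ) - f t) / F δ) t :=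
      (((hF (t + δ)).comp_add_const t δ).sub (hF t)).div_const _
    have h2 : (f (t + δ) - f t) / F δ = f t * z := by
      rw [hmul t δ ht hδ.le]; simp only [z]; ring
    rw [h2] at h1
    exact h1.hasDerivWithinAt.congr (fun x hx => hrep x (ht.trans hx)) (hrep t ht)
  refine ⟨z, fun t ht => ?_⟩
  have hconst := constant_of_has_deriv_right_zero
    (f := fun t : ℝ => f t * Complex.exp (-((t : ℂ) * z))) (a := 0) (b := t)
    (by fun_prop) (by
      intro x hx
      have h1 : HasDerivAt (fun t : ℝ => -((t : ℂ) * z)) (-(1 * z)) x :=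
        ((HasDerivAt.ofReal_comp (hasDerivAt_id x)).mul_const z).neg
      have h3 := (hder x hx.1).mul h1.cexp.hasDerivWithinAt
      have h4 : f x * z * Complex.exp (-((x : ℂ) * z)) +
          f x * (Complex.exp (-((x : ℂ) * z)) * -(1 * z)) = 0 := by ring
      rw [h4] at h3
      exact h3) t (right_mem_Icc.2 ht)
  simp only [h0, Complex.ofReal_zero, zero_mul, neg_zero, Complex.exp_zero, mul_one] at hconst
  rw [Complex.exp_neg] at hconst
  field_simp at hconst
  exact hconst

theorem IsLevyProcess.charFun_eq {Ω : Type*} [MeasurableSpace Ω] {L : ℝ≥0 → Ω → ℝ}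
    {P : Measure Ω} [IsProbabilityMeasure P] (hL : IsLevyProcess L P) (t : ℝ≥0) (u : ℝ) :
    charFun (P.map (L t)) u = Complex.exp (((t : ℝ) : ℂ) * charExponent L P u) := by
  let φ : ℝ≥0 → ℂ := fun t => charFun (P.map (L t)) u
  have hφ0 : φ 0 = 1 := by
    have h1 : P.map (L 0) = Measure.dirac 0 := by
      rw [Measure.map_congr (g := fun _ => (0 : ℝ)) hL.start_zero]
      simp
    simp [φ, h1]
  have hstat : ∀ s t, P.map (fun ω => L (s + t) ω - L s ω) = P.map (L t) := by
    intro s t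
    rw [hL.stationary s t]
    refine Measure.map_congr ?_
    filter_upwards [hL.start_zero] with ω hω
    simp [hω]
  have hmul : ∀ s t, φ (s + t) = φ s * φ t := by
    intro s t
    have hind : (L s) ⟂ᵢ[P] (L (s + t) - L s) :=
      hL.indep.indepFun_eval_sub (zero_le) (le_self_add) hL.start_zero
    have h1 := hind.charFun_map_add_eq_mul (hL.measurable s).aemeasurable
      ((hL.measurable (s + t)).sub (hL.measurable s)).aemeasurable
    have h2 : L s + (L (s + t) - L s) = L (s + t) := by abel
    rw [h2] at h1
    have h3 := congrFun h1 u
    have h4 : P.map (L (s + t) - L s) = P.map (L t) := hstat s t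
    rw [h4] at h3
    exact h3
  have hcont : Continuous φ := by
    rw [continuous_iff_continuousAt]
    intro t
    refine tendsto_of_seq_tendsto fun x hx => ?_
    have h0 : TendstoInMeasure P (fun n => L (x n)) atTop (L t) :=
      fun ε hε => (hL.stoch_cont t ε hε).comp hx
    have h1 := h0.tendstoInDistribution fun n => (hL.measurable (x n)).aemeasurable
    have h2 := (ProbabilityMeasure.tendsto_iff_tendsto_charFun).1 h1.tendsto u
    exact h2
  obtain ⟨z, hz⟩ := exists_exp_of_mul (f := fun t => φ t.toNNReal)
    (hcont.comp continuous_real_toNNReal) (by simpa using hφ0)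
    (fun s t hs ht => by
      rw [Real.toNNReal_add hs ht, hmul])
  have hz' : ∀ t : ℝ≥0, charFun (P.map (L t)) u = Complex.exp (((t : ℝ) : ℂ) * z) := by
    intro t
    have := hz t t.2
    simpa [φ] using this
  rw [charExponent_eq hz']
  exact hz' t

/-- The transition operators `P_t f (x) = E[f (L_t + x)]` of the process `L`. -/
noncomputable def transitionOp {Ω : Type*} [MeasurableSpace Ω] (L : ℝ≥0 → Ω → ℝ) (P : Measure Ω)
    (t : ℝ≥0) (f : C₀(ℝ, ℝ)) (x : ℝ) : ℝ :=
  ∫ ω, f (L t ω + x) ∂P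

/-- `f` lies in the domain of the infinitesimal generator `A` of `L` on `C₀(ℝ)` and `A f = g`:
`(P_t f - f) / t` converges to `g ∈ C₀(ℝ)` in the sup-norm as `t` decreases to `0`. -/
def HasGenerator {Ω : Type*} [MeasurableSpace Ω] (L : ℝ≥0 → Ω → ℝ) (P : Measure Ω)
    (f g : C₀(ℝ, ℝ)) : Prop :=
  TendstoUniformly (fun (t : ℝ≥0) (x : ℝ) => (t : ℝ)⁻¹ * (transitionOp L P t f x - f x)) g
    (𝓝[>] (0 : ℝ≥0))

/-- The dual process `-L`. -/
def dualProcess {Ω : Type*} (L : ℝ≥0 → Ω → ℝ) : ℝ≥0 → Ω → ℝ := fun t ω => -L t ω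

/-- `H ∈ D(A*) ⊆ C₀(ℝ)` and `A* H = g`, where `A*` is the generator of the dual process `-L`. -/
def SolvesPoisson {Ω : Type*} [MeasurableSpace Ω] (L : ℝ≥0 → Ω → ℝ) (P : Measure Ω)
    (H g : C₀(ℝ, ℝ)) : Prop :=
  HasGenerator (dualProcess L) P H g

/-- The Fourier transform `ĝ(ξ) = ∫ exp (i ξ x) g(x) dx`. -/
noncomputable def fourierHat (g : ℝ → ℝ) (ξ : ℝ) : ℂ :=
  ∫ x : ℝ, Complex.exp (Complex.I * ξ * x) * (g x : ℂ)

/-- The quotient `a / b` is locally bounded at zero: it is bounded on a punctured neighbourhood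
of `0`. -/
def QuotientLocallyBoundedAtZero (a b : ℝ → ℂ) : Prop :=
  ∃ ε > 0, ∃ C : ℝ, ∀ ξ : ℝ, ξ ≠ 0 → |ξ| < ε → ‖a ξ / b ξ‖ ≤ C

/-!
The solution `H` is tested against the Fejér kernels `ψ = fejer a`, which are nonnegative,
integrable, and Fourier integrals of the triangle functions supported in `[-a, a]`. If `a` is so
small that `‖ĝ / η‖ ≤ C` on the punctured support, then `∫ H ψ ≤ 2C`, uniformly in `a`. Since
`H ≥ 0` and `ψ ≥ 4 / π ^ 2` on `[-1 / a, 1 / a]`, letting `a` tend to zero bounds `∫ H`.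

For the uniform bound, let `u t = ∫ E[H (x - L_t)] ψ(x) dx` (`fejerPairing`), so that
`u 0 = ∫ H ψ`.

* By the Poisson equation `u' t = ∫ E[g (x - L_t)] ψ(x) dx`, and on the Fourier side this is
  `∫ triangle(ξ) ĝ(ξ) exp (t η(ξ)) dξ`. Hence `u T - u 0` is the integral of
  `triangle(ξ) ĝ(ξ) (exp (T η(ξ)) - 1) / η(ξ)`, which is at most `2C` in absolute value because
  `‖exp (T η)‖ ≤ 1` (`IsConvSemigroup.abs_fejerPairing_sub_le`). As the generator is a one-sided
  uniform limit at time zero, time is discretised and the resulting Riemann sums are evaluated as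
  geometric series.
* The averages `N⁻¹ ∑_{j < N} u (j t)` tend to zero for a suitable `t`
  (`IsConvSemigroup.tendsto_average_fejerPairing`). After approximating `H` uniformly by an
  integrable function, this is dominated convergence on the Fourier side: the Cesàro means of
  `E[exp (i ξ L_t)] ^ j` vanish where the characteristic function is not one.

Both points need that `η` and `1 - E[exp (i ξ L_t)]` vanish on a null set only. This is where `L`
is used not to be constant: some `L_t` is not almost surely zero, and the characteristic function of
its law equals one on a null set only (`ae_charFun_ne_one`).
-/

/-! ### Averages of translates -/

/-- `shiftMean μ f z = E[f (z + Y)]` where `Y` has law `μ`. -/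
noncomputable def shiftMean (μ : Measure ℝ) (f : ℝ → ℝ) (z : ℝ) : ℝ :=
  ∫ y, f (z + y) ∂μ

theorem shiftMean_nonneg {μ : Measure ℝ} {f : ℝ → ℝ} (h0 : ∀ x, 0 ≤ f x) (z : ℝ) :
    0 ≤ shiftMean μ f z :=
  integral_nonneg fun _ => h0 _

section shiftMean

variable {μ : Measure ℝ} [IsProbabilityMeasure μ] {f : ℝ → ℝ}

theorem integrable_prod_shift (hf : Integrable f) (hfm : Measurable f) :
    Integrable (fun p : ℝ × ℝ => f (p.1 + p.2)) (volume.prod μ) := by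
  have hm : Measurable fun p : ℝ × ℝ => f (p.1 + p.2) :=
    hfm.comp (measurable_fst.add measurable_snd)
  rw [integrable_prod_iff' hm.aestronglyMeasurable]
  refine ⟨ae_of_all _ fun y => hf.comp_add_right y, ?_⟩
  simp only [integral_add_right_eq_self fun x => ‖f x‖]
  exact integrable_const _

theorem measurable_shiftMean (hfm : Measurable f) : Measurable (shiftMean μ f) := by
  have : StronglyMeasurable (Function.uncurry fun z y : ℝ => f (z + y)) :=
    (hfm.comp (measurable_fst.add measurable_snd)).stronglyMeasurable
  exact this.integral_prod_right.measurable

theorem integrable_shiftMean (hf : Integrable f) (hfm : Measurable f) :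
    Integrable (shiftMean μ f) :=
  (integrable_prod_shift (μ := μ) hf hfm).integral_prod_left

theorem integral_shiftMean (hf : Integrable f) (hfm : Measurable f) :
    ∫ z, shiftMean μ f z = ∫ x, f x := by
  unfold shiftMean
  rw [integral_integral_swap (integrable_prod_shift (μ := μ) hf hfm)]
  simp [integral_add_right_eq_self f]

/-- Averaging over translates by `Y` is adjoint to averaging over translates by `-Y`. -/
theorem integral_mul_shiftMean {h : ℝ → ℝ} {M : ℝ} (hhm : Measurable h) (hM : ∀ x, |h x| ≤ M)
    (hf : Integrable f) (hfm : Measurable f) :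
    ∫ z, h z * shiftMean μ f z = ∫ x, (∫ y, h (x - y) ∂μ) * f x := by
  unfold shiftMean
  simp only [← integral_const_mul, ← integral_mul_const]
  have h1 : Integrable (Function.uncurry fun x y => h (x - y) * f x) (volume.prod μ) :=
    (hf.comp_fst μ).bdd_mul (c := M)
      (hhm.comp (measurable_fst.sub measurable_snd)).aestronglyMeasurable
      (ae_of_all _ fun p => hM _)
  have h2 : Integrable (Function.uncurry fun z y => h z * f (z + y)) (volume.prod μ) :=
    (integrable_prod_shift (μ := μ) hf hfm).bdd_mul (c := M)
      (hhm.comp measurable_fst).aestronglyMeasurable (ae_of_all _ fun p => hM _)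
  rw [integral_integral_swap h1, integral_integral_swap h2]
  refine integral_congr_ae (ae_of_all _ fun y => ?_)
  simpa using integral_add_right_eq_self (μ := volume) (fun x => h (x - y) * f x) y

theorem abs_integral_mul_le {h w : ℝ → ℝ} {M : ℝ} (hM : ∀ x, |h x| ≤ M) (hw : Integrable w)
    (h0 : ∀ x, 0 ≤ w x) : |∫ z, h z * w z| ≤ M * ∫ x, w x := by
  rw [← integral_const_mul, ← Real.norm_eq_abs]
  refine norm_integral_le_of_norm_le (hw.const_mul M) (ae_of_all _ fun x => ?_)
  rw [Real.norm_eq_abs, abs_mul, abs_of_nonneg (h0 x)]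
  exact mul_le_mul_of_nonneg_right (hM x) (h0 x)

end shiftMean

/-! ### Fourier integrals -/

/-- The Fourier integral `∫ exp (i ξ z) κ(ξ) dξ` of a density `κ` on the frequency side. -/
noncomputable def freqIntegral (κ : ℝ → ℂ) (z : ℝ) : ℂ :=
  ∫ ξ : ℝ, Complex.exp (Complex.I * ξ * z) * κ ξ

theorem norm_exp_I_mul (ξ z : ℝ) : ‖Complex.exp (Complex.I * ξ * z)‖ = 1 := by
  rw [Complex.norm_exp]
  simp

theorem norm_fourierHat_le (h : ℝ → ℝ) (ξ : ℝ) : ‖fourierHat h ξ‖ ≤ ∫ x, |h x| := by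
  refine (norm_integral_le_integral_norm _).trans_eq ?_
  simp [norm_exp_I_mul]

theorem continuous_fourierHat {h : ℝ → ℝ} (hh : Integrable h) : Continuous (fourierHat h) := by
  refine continuous_of_dominated (bound := fun x => |h x|) (fun ξ => ?_) (fun ξ => ?_) hh.abs ?_
  · exact (by fun_prop : Continuous fun x : ℝ => Complex.exp (Complex.I * ξ * x))
      |>.aestronglyMeasurable.mul hh.ofReal.aestronglyMeasurable
  · exact ae_of_all _ fun x => by simp [norm_exp_I_mul]
  · exact ae_of_all _ fun x => by fun_prop

/-- Parseval's identity for an integrable function against a Fourier integral. -/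
theorem integral_mul_freqIntegral {h : ℝ → ℝ} {κ : ℝ → ℂ} (hh : Integrable h)
    (hκ : Integrable κ) :
    ∫ z, (h z : ℂ) * freqIntegral κ z = ∫ ξ, κ ξ * fourierHat h ξ := by
  unfold freqIntegral fourierHat
  simp only [← integral_const_mul]
  rw [integral_integral_swap]
  · refine integral_congr_ae (ae_of_all _ fun ξ => integral_congr_ae (ae_of_all _ fun z => ?_))
    simp only
    ring
  · have h1 : Integrable (fun p : ℝ × ℝ => (h p.1 : ℂ) * κ p.2) (volume.prod volume) :=
      hh.ofReal.mul_prod hκ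
    refine (h1.bdd_mul (c := 1)
      (f := fun p : ℝ × ℝ => Complex.exp (Complex.I * p.2 * p.1)) ?_ ?_).congr ?_
    · exact (by fun_prop : Continuous fun p : ℝ × ℝ => Complex.exp (Complex.I * p.2 * p.1))
        |>.aestronglyMeasurable
    · exact ae_of_all _ fun p => (norm_exp_I_mul _ _).le
    · refine ae_of_all _ fun p => ?_
      simp only [Function.uncurry]
      ring

/-- Averaging over translates multiplies the frequency density by the characteristic function. -/
theorem integral_freqIntegral_add {κ : ℝ → ℂ} (hκ : Integrable κ) (μ : Measure ℝ)
    [IsProbabilityMeasure μ] (z : ℝ) :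
    ∫ y, freqIntegral κ (z + y) ∂μ = freqIntegral (fun ξ => charFun μ ξ * κ ξ) z := by
  unfold freqIntegral
  rw [integral_integral_swap]
  · refine integral_congr_ae (ae_of_all _ fun ξ => ?_)
    simp only [charFun_apply_real, ← integral_const_mul, ← integral_mul_const]
    refine integral_congr_ae (ae_of_all _ fun y => ?_)
    simp only [Complex.ofReal_add, mul_add, Complex.exp_add]
    rw [show Complex.I * (ξ : ℂ) * (y : ℂ) = ξ * y * Complex.I by ring]
    ring
  · have h1 : Integrable (fun p : ℝ × ℝ => κ p.2) (μ.prod volume) := hκ.comp_snd μ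
    refine h1.bdd_mul (c := 1)
      (f := fun p : ℝ × ℝ => Complex.exp (Complex.I * p.2 * ((z + p.1 : ℝ) : ℂ))) ?_ ?_
    · exact (by fun_prop : Continuous fun p : ℝ × ℝ =>
        Complex.exp (Complex.I * p.2 * ((z + p.1 : ℝ) : ℂ))) |>.aestronglyMeasurable
    · exact ae_of_all _ fun p => (norm_exp_I_mul _ _).le

theorem shiftMean_eq_freqIntegral {ψ : ℝ → ℝ} {κ : ℝ → ℂ} (hκ : Integrable κ)
    (hψ : ∀ x, (ψ x : ℂ) = freqIntegral κ x) (μ : Measure ℝ) [IsProbabilityMeasure μ] (z : ℝ) :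
    ((shiftMean μ ψ z : ℝ) : ℂ) = freqIntegral (fun ξ => charFun μ ξ * κ ξ) z := by
  rw [← integral_freqIntegral_add hκ, shiftMean, ← integral_complex_ofReal]
  simp only [hψ]

theorem integrable_charFun_mul {κ : ℝ → ℂ} (hκ : Integrable κ) (μ : Measure ℝ)
    [IsProbabilityMeasure μ] : Integrable fun ξ => charFun μ ξ * κ ξ :=
  hκ.bdd_mul (c := 1) continuous_charFun.aestronglyMeasurable
    (ae_of_all _ fun ξ => norm_charFun_le_one ξ)

/-! ### The Fejér kernel -/

/-- The triangle function on `[-a, a]`, normalised to have integral one. -/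
noncomputable def triangle (a ξ : ℝ) : ℝ := max 0 (a - |ξ|) / a ^ 2

/-- The Fejér kernel: the Fourier integral of `triangle a`. -/
noncomputable def fejer (a x : ℝ) : ℝ := ∫ ξ, triangle a ξ * Real.cos (ξ * x)

theorem triangle_nonneg (a ξ : ℝ) : 0 ≤ triangle a ξ := by unfold triangle; positivity

theorem triangle_eq_zero {a ξ : ℝ} (h : a ≤ |ξ|) : triangle a ξ = 0 := by
  rw [triangle, max_eq_left (by linarith), zero_div]

theorem continuous_triangle (a : ℝ) : Continuous (triangle a) := by
  unfold triangle; fun_prop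

theorem integrable_triangle (a : ℝ) : Integrable (triangle a) := by
  refine (continuous_triangle a).integrable_of_hasCompactSupport ?_
  refine HasCompactSupport.intro (K := Icc (-a) a) isCompact_Icc fun x hx => ?_
  refine triangle_eq_zero (le_of_not_gt fun h => hx ?_)
  exact ⟨(abs_lt.1 h).1.le, (abs_lt.1 h).2.le⟩

theorem integrable_ofReal_triangle (a : ℝ) : Integrable fun ξ => (triangle a ξ : ℂ) :=
  (integrable_triangle a).ofReal

theorem fejer_eq_intervalIntegral_cos {a : ℝ} (ha : 0 < a) (x : ℝ) :
    fejer a x = 2 * ∫ r in (0 : ℝ)..a, (a - r) / a ^ 2 * Real.cos (r * x) := by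
  have h1 : fejer a x
      = ∫ ξ, (fun r => max 0 (a - r) / a ^ 2 * Real.cos (r * x)) |ξ| := by
    refine integral_congr_ae (ae_of_all _ fun ξ => ?_)
    have : Real.cos (|ξ| * x) = Real.cos (ξ * x) := by
      rcases abs_choice ξ with h | h <;> simp [h]
    simp [triangle, this]
  rw [h1, integral_comp_abs (f := fun r => max 0 (a - r) / a ^ 2 * Real.cos (r * x)),
    intervalIntegral.integral_of_le ha.le]
  congr 1
  have h2 : ∀ r, a < r → max 0 (a - r) / a ^ 2 * Real.cos (r * x) = 0 := fun r hr => by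
    rw [max_eq_left (by linarith)]; simp
  rw [setIntegral_eq_of_subset_of_forall_sdiff_eq_zero measurableSet_Ioi Ioc_subset_Ioi_self
    fun r hr => h2 r (not_le.1 fun h => hr.2 ⟨hr.1, h⟩)]
  refine setIntegral_congr_fun measurableSet_Ioc fun r hr => ?_
  rw [max_eq_right (by linarith [hr.2])]

theorem fejer_eq {a x : ℝ} (ha : 0 < a) (hx : x ≠ 0) :
    fejer a x = 2 * (1 - Real.cos (a * x)) / (a * x) ^ 2 := by
  rw [fejer_eq_intervalIntegral_cos ha]
  -- an antiderivative, from integration by parts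
  have hd : ∀ r ∈ uIcc 0 a, HasDerivAt
      (fun r => ((a - r) * Real.sin (r * x) / x - Real.cos (r * x) / x ^ 2) / a ^ 2)
      ((a - r) / a ^ 2 * Real.cos (r * x)) r := by
    intro r _
    have h0 : HasDerivAt (fun r : ℝ => r * x) (1 * x) r := (hasDerivAt_id r).mul_const x
    have h1 := ((((hasDerivAt_id r).const_sub a).mul h0.sin).div_const x).sub
      (h0.cos.div_const (x ^ 2))
    convert! h1.div_const (a ^ 2) using 1
    simp only [id]
    field_simp
    ring
  rw [intervalIntegral.integral_eq_sub_of_hasDerivAt hd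
    (Continuous.intervalIntegrable (by fun_prop) _ _)]
  simp
  field_simp
  ring

theorem fejer_zero {a : ℝ} (ha : 0 < a) : fejer a 0 = 1 := by
  rw [fejer_eq_intervalIntegral_cos ha]
  have h : (fun r : ℝ => (a - r) / a ^ 2 * Real.cos (r * 0)) = fun r => (a - r) / a ^ 2 := by
    simp
  rw [h, intervalIntegral.integral_div, intervalIntegral.integral_sub (by simp) (by simp)]
  simp
  field_simp
  norm_num

theorem integral_triangle {a : ℝ} (ha : 0 < a) : ∫ ξ, triangle a ξ = 1 := by
  rw [← fejer_zero ha]; simp [fejer]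

theorem fejer_nonneg {a : ℝ} (ha : 0 < a) (x : ℝ) : 0 ≤ fejer a x := by
  rcases eq_or_ne x 0 with rfl | hx
  · rw [fejer_zero ha]; exact zero_le_one
  · rw [fejer_eq ha hx]
    have := Real.cos_le_one (a * x)
    exact div_nonneg (by linarith) (sq_nonneg _)

theorem fejer_le_one {a : ℝ} (ha : 0 < a) (x : ℝ) : fejer a x ≤ 1 := by
  rw [← integral_triangle ha]
  refine integral_mono ((integrable_triangle a).mul_bdd (c := 1) (by fun_prop)
    (ae_of_all _ fun ξ => Real.abs_cos_le_one _)) (integrable_triangle a) fun ξ => ?_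
  exact mul_le_of_le_one_right (triangle_nonneg a ξ) (Real.cos_le_one _)

theorem le_fejer {a x : ℝ} (ha : 0 < a) (hx : |a * x| ≤ 1) : 4 / Real.pi ^ 2 ≤ fejer a x := by
  rcases eq_or_ne x 0 with rfl | hx0
  · rw [fejer_zero ha, div_le_one (by positivity)]
    nlinarith [Real.pi_gt_three]
  · rw [fejer_eq ha hx0, le_div_iff₀ (by positivity)]
    have := Real.cos_le_one_sub_mul_cos_sq (x := a * x) (by linarith [Real.pi_gt_three])
    have h2 : 4 / Real.pi ^ 2 * (a * x) ^ 2 = 2 * (2 / Real.pi ^ 2 * (a * x) ^ 2) := by ring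
    linarith

theorem continuous_fejer (a : ℝ) : Continuous (fejer a) := by
  refine continuous_of_dominated (bound := triangle a) (fun x => ?_) (fun x => ?_)
    (integrable_triangle a) (ae_of_all _ fun ξ => by fun_prop)
  · exact ((continuous_triangle a).mul (by fun_prop)).aestronglyMeasurable
  · refine ae_of_all _ fun ξ => ?_
    rw [norm_mul, Real.norm_of_nonneg (triangle_nonneg a ξ)]
    exact mul_le_of_le_one_right (triangle_nonneg a ξ) (Real.abs_cos_le_one _)

theorem integrable_fejer {a : ℝ} (ha : 0 < a) : Integrable (fejer a) := by
  refine (integrable_inv_one_add_sq.const_mul (1 + 4 / a ^ 2)).mono'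
    (continuous_fejer a).aestronglyMeasurable (ae_of_all _ fun x => ?_)
  rw [Real.norm_of_nonneg (fejer_nonneg ha x), ← div_eq_mul_inv, le_div_iff₀ (by positivity)]
  have h1 : fejer a x * x ^ 2 ≤ 4 / a ^ 2 := by
    rcases eq_or_ne x 0 with rfl | hx
    · simp; positivity
    · rw [fejer_eq ha hx]
      have := Real.neg_one_le_cos (a * x)
      rw [show 2 * (1 - Real.cos (a * x)) / (a * x) ^ 2 * x ^ 2
        = 2 * (1 - Real.cos (a * x)) / a ^ 2 by field_simp]
      gcongr
      linarith
  nlinarith [fejer_le_one ha x]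

theorem fejer_eq_freqIntegral (a x : ℝ) :
    (fejer a x : ℂ) = freqIntegral (fun ξ => (triangle a ξ : ℂ)) x := by
  have hc : Integrable fun ξ => triangle a ξ * Real.cos (ξ * x) :=
    (integrable_triangle a).mul_bdd (c := 1) (by fun_prop)
      (ae_of_all _ fun ξ => Real.abs_cos_le_one _)
  have hs : Integrable fun ξ => triangle a ξ * Real.sin (ξ * x) :=
    (integrable_triangle a).mul_bdd (c := 1) (by fun_prop)
      (ae_of_all _ fun ξ => Real.abs_sin_le_one _)
  -- the sine part is odd
  have h0 : ∫ ξ, triangle a ξ * Real.sin (ξ * x) = 0 := by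
    have h := integral_neg_eq_self (fun ξ => triangle a ξ * Real.sin (ξ * x)) volume
    simp only [triangle, abs_neg, neg_mul, Real.sin_neg, mul_neg, integral_neg] at h ⊢
    linarith
  have h1 : freqIntegral (fun ξ => (triangle a ξ : ℂ)) x
      = ∫ ξ, (((triangle a ξ * Real.cos (ξ * x) : ℝ) : ℂ)
        + ((triangle a ξ * Real.sin (ξ * x) : ℝ) : ℂ) * Complex.I) := by
    refine integral_congr_ae (ae_of_all _ fun ξ => ?_)
    simp only
    rw [show Complex.I * (ξ : ℂ) * (x : ℂ) = ((ξ * x : ℝ) : ℂ) * Complex.I by push_cast; ring,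
      Complex.exp_mul_I]
    push_cast
    ring
  rw [h1, integral_add hc.ofReal (hs.ofReal.mul_const _), integral_mul_const,
    integral_complex_ofReal, integral_complex_ofReal, h0]
  simp [fejer]

/-! ### The pairing of a function with the smoothed transition laws -/

/-- The laws `ν t` form a convolution semigroup of probability measures with characteristic
exponent `η`. The semigroup property is encoded by the exponential form of the characteristic
functions. -/
structure IsConvSemigroup (ν : ℝ≥0 → Measure ℝ) (η : ℝ → ℂ) : Prop where
  prob : ∀ t, IsProbabilityMeasure (ν t)
  charFun_eq : ∀ t ξ, charFun (ν t) ξ = Complex.exp (((t : ℝ) : ℂ) * η ξ)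

/-- `fejerPairing ν a h t = ∫ h(z) E[ψ (z + Y)] dz`, where `ψ` is the Fejér kernel `fejer a` and
`Y` has law `ν t`; equivalently the integral of `E[h (x - Y)] ψ(x)` over `x`. -/
noncomputable def fejerPairing (ν : ℝ≥0 → Measure ℝ) (a : ℝ) (h : ℝ → ℝ) (t : ℝ≥0) : ℝ :=
  ∫ z, h z * shiftMean (ν t) (fejer a) z

namespace IsConvSemigroup

variable {ν : ℝ≥0 → Measure ℝ} {η : ℝ → ℂ} {a : ℝ}

theorem norm_exp_le_one (hν : IsConvSemigroup ν η)
    (t : ℝ≥0) (ξ : ℝ) : ‖Complex.exp (((t : ℝ) : ℂ) * η ξ)‖ ≤ 1 := by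
  have := hν.prob t
  rw [← hν.charFun_eq]
  exact norm_charFun_le_one ξ

theorem shiftMean_fejer (hν : IsConvSemigroup ν η) (a : ℝ) (t : ℝ≥0) (z : ℝ) :
    ((shiftMean (ν t) (fejer a) z : ℝ) : ℂ)
      = freqIntegral (fun ξ => Complex.exp (((t : ℝ) : ℂ) * η ξ) * triangle a ξ) z := by
  have := hν.prob t
  rw [shiftMean_eq_freqIntegral (integrable_ofReal_triangle a) (fejer_eq_freqIntegral a)]
  simp only [hν.charFun_eq]

theorem integrable_exp_mul_triangle (hν : IsConvSemigroup ν η) (a : ℝ) (t : ℝ≥0) :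
    Integrable fun ξ => Complex.exp (((t : ℝ) : ℂ) * η ξ) * (triangle a ξ : ℂ) := by
  have := hν.prob t
  simpa only [hν.charFun_eq] using
    integrable_charFun_mul (integrable_ofReal_triangle a) (ν t)

theorem shiftMean_zero (hν : IsConvSemigroup ν η)
    (a : ℝ) : shiftMean (ν 0) (fejer a) = fejer a := by
  funext z
  have h := hν.shiftMean_fejer a 0 z
  simp only [NNReal.coe_zero, Complex.ofReal_zero, zero_mul, Complex.exp_zero, one_mul] at h
  rw [← fejer_eq_freqIntegral] at h
  exact_mod_cast h

/-- The semigroup property, which on the frequency side is multiplicativity of the exponentials. -/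
theorem shiftMean_add (hν : IsConvSemigroup ν η) (a : ℝ) (s t : ℝ≥0) :
    shiftMean (ν (s + t)) (fejer a) = shiftMean (ν s) (shiftMean (ν t) (fejer a)) := by
  have := hν.prob s
  funext z
  have h := shiftMean_eq_freqIntegral (hν.integrable_exp_mul_triangle a t)
    (hν.shiftMean_fejer a t) (ν s) z
  have h' := hν.shiftMean_fejer a (s + t) z
  simp only [hν.charFun_eq, ← mul_assoc, ← Complex.exp_add, ← add_mul] at h
  simp only [NNReal.coe_add, Complex.ofReal_add] at h'
  rw [← h] at h'
  exact_mod_cast h'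

theorem integrable_shiftMean_fejer (hν : IsConvSemigroup ν η) (ha : 0 < a) (t : ℝ≥0) :
    Integrable (shiftMean (ν t) (fejer a)) := by
  have := hν.prob t
  exact integrable_shiftMean (integrable_fejer ha) (continuous_fejer a).measurable

theorem measurable_shiftMean_fejer (hν : IsConvSemigroup ν η) (a : ℝ) (t : ℝ≥0) :
    Measurable (shiftMean (ν t) (fejer a)) := by
  have := hν.prob t
  exact measurable_shiftMean (continuous_fejer a).measurable

theorem abs_integral_mul_shiftMean_le (hν : IsConvSemigroup ν η)
    (ha : 0 < a) {h : ℝ → ℝ} {M : ℝ} (hM : ∀ x, |h x| ≤ M)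
    (t : ℝ≥0) :
    |∫ z, h z * shiftMean (ν t) (fejer a) z| ≤ M * ∫ x, fejer a x := by
  have := hν.prob t
  rw [← integral_shiftMean (μ := ν t) (integrable_fejer ha) (continuous_fejer a).measurable]
  exact abs_integral_mul_le hM (hν.integrable_shiftMean_fejer ha t)
    (shiftMean_nonneg (fejer_nonneg ha))

theorem integrable_mul_shiftMean (hν : IsConvSemigroup ν η)
    (ha : 0 < a) {h : ℝ → ℝ} {M : ℝ} (hhm : Measurable h)
    (hM : ∀ x, |h x| ≤ M) (t : ℝ≥0) :
    Integrable fun z => h z * shiftMean (ν t) (fejer a) z :=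
  (hν.integrable_shiftMean_fejer ha t).bdd_mul (c := M) hhm.aestronglyMeasurable
    (ae_of_all _ hM)

theorem ofReal_fejerPairing (hν : IsConvSemigroup ν η)
    (a : ℝ) {h : ℝ → ℝ} (hh : Integrable h) (t : ℝ≥0) :
    (fejerPairing ν a h t : ℂ)
      = ∫ ξ, Complex.exp (((t : ℝ) : ℂ) * η ξ) * (triangle a ξ * fourierHat h ξ) := by
  rw [fejerPairing, ← integral_complex_ofReal]
  simp only [Complex.ofReal_mul, hν.shiftMean_fejer]
  rw [integral_mul_freqIntegral hh (hν.integrable_exp_mul_triangle a t)]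
  simp only [mul_assoc]

theorem integrable_exp_mul_triangle_mul (hν : IsConvSemigroup ν η)
    (a : ℝ) {h : ℝ → ℝ} (hh : Integrable h) (t : ℝ≥0) :
    Integrable fun ξ => Complex.exp (((t : ℝ) : ℂ) * η ξ) * (triangle a ξ * fourierHat h ξ) := by
  simp only [← mul_assoc]
  exact (hν.integrable_exp_mul_triangle a t).mul_bdd
    (continuous_fourierHat hh).aestronglyMeasurable (ae_of_all _ (norm_fourierHat_le h))

/-- One small time step of the pairing, compared with its infinitesimal counterpart. -/
theorem abs_fejerPairing_step_le (hν : IsConvSemigroup ν η)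
    (ha : 0 < a) {H g : ℝ → ℝ} {M M' : ℝ} (hHm : Measurable H)
    (hM : ∀ x, |H x| ≤ M) (hgm : Measurable g) (hM' : ∀ x, |g x| ≤ M') {δ : ℝ≥0} (hδ : 0 < δ)
    {ε : ℝ} (hε : ∀ x, |(δ : ℝ)⁻¹ * ((∫ y, H (x - y) ∂(ν δ)) - H x) - g x| ≤ ε) (t : ℝ≥0) :
    |fejerPairing ν a H (δ + t) - fejerPairing ν a H t - δ * fejerPairing ν a g t|
      ≤ δ * ε * ∫ x, fejer a x := by
  have := hν.prob δ
  have hδ' : (0 : ℝ) < δ := hδ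
  have hQm : Measurable fun x => ∫ y, H (x - y) ∂(ν δ) := by
    have : StronglyMeasurable (Function.uncurry fun x y : ℝ => H (x - y)) :=
      (hHm.comp (measurable_fst.sub measurable_snd)).stronglyMeasurable
    exact this.integral_prod_right.measurable
  have hQM : ∀ x, |∫ y, H (x - y) ∂(ν δ)| ≤ M := fun x => by
    simpa using norm_integral_le_of_norm_le_const (μ := ν δ) (f := fun y => H (x - y)) (C := M)
      (ae_of_all _ fun y => hM (x - y))
  have h1 : fejerPairing ν a H (δ + t)
      = ∫ x, (∫ y, H (x - y) ∂(ν δ)) * shiftMean (ν t) (fejer a) x := by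
    rw [fejerPairing, hν.shiftMean_add,
      integral_mul_shiftMean hHm hM (hν.integrable_shiftMean_fejer ha t)
        (hν.measurable_shiftMean_fejer a t)]
  have h2 : fejerPairing ν a H (δ + t) - fejerPairing ν a H t - δ * fejerPairing ν a g t
      = ∫ x, ((∫ y, H (x - y) ∂(ν δ)) - H x - δ * g x) * shiftMean (ν t) (fejer a) x := by
    simp only [sub_mul, mul_assoc]
    have i1 := hν.integrable_mul_shiftMean ha hQm hQM t
    have i2 := hν.integrable_mul_shiftMean ha hHm hM t
    have i3 := (hν.integrable_mul_shiftMean ha hgm hM' t).const_mul (δ : ℝ)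
    have h12 := integral_sub i1 i2
    have h123 := integral_sub (i1.sub i2) i3
    simp only [Pi.sub_apply, integral_const_mul] at h123
    rw [h123, h12, h1]
    rfl
  rw [h2]
  refine hν.abs_integral_mul_shiftMean_le ha (fun x => ?_) t
  have h3 : (∫ y, H (x - y) ∂(ν δ)) - H x - δ * g x
      = δ * ((δ : ℝ)⁻¹ * ((∫ y, H (x - y) ∂(ν δ)) - H x) - g x) := by
    field_simp
  rw [h3, abs_mul, abs_of_pos hδ']
  exact mul_le_mul_of_nonneg_left (hε x) hδ'.le

/-- The accumulated error of `m` time steps of length `δ`. -/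
theorem abs_fejerPairing_sub_sum_le (hν : IsConvSemigroup ν η)
    (ha : 0 < a) {H g : ℝ → ℝ} {M M' : ℝ} (hHm : Measurable H)
    (hM : ∀ x, |H x| ≤ M) (hgm : Measurable g) (hM' : ∀ x, |g x| ≤ M') {δ : ℝ≥0} (hδ : 0 < δ)
    {ε : ℝ} (hε : ∀ x, |(δ : ℝ)⁻¹ * ((∫ y, H (x - y) ∂(ν δ)) - H x) - g x| ≤ ε) (m : ℕ) :
    |fejerPairing ν a H (m * δ) - fejerPairing ν a H 0
        - ∑ j ∈ Finset.range m, δ * fejerPairing ν a g (j * δ)|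
      ≤ m * (δ * ε * ∫ x, fejer a x) := by
  have h1 : fejerPairing ν a H (m * δ) - fejerPairing ν a H 0
      - ∑ j ∈ Finset.range m, δ * fejerPairing ν a g (j * δ)
      = ∑ j ∈ Finset.range m, (fejerPairing ν a H (δ + j * δ) - fejerPairing ν a H (j * δ)
        - δ * fejerPairing ν a g (j * δ)) := by
    have h := Finset.sum_range_sub (fun j : ℕ => fejerPairing ν a H (j * δ)) m
    simp only [Nat.cast_zero, zero_mul] at h
    rw [Finset.sum_sub_distrib, ← h]
    refine congrArg₂ _ (Finset.sum_congr rfl fun j _ => ?_) rfl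
    rw [show ((j + 1 : ℕ) : ℝ≥0) * δ = δ + j * δ by push_cast; ring]
  rw [h1]
  refine (Finset.abs_sum_le_sum_abs _ _).trans ?_
  refine (Finset.sum_le_card_nsmul (Finset.range m) _ _ fun j _ =>
    hν.abs_fejerPairing_step_le ha hHm hM hgm hM' hδ hε (j * δ)).trans_eq ?_
  simp

end IsConvSemigroup

/-- Riemann sums of `s ↦ exp (s z)` over `[0, T]`, summed as geometric series. -/
theorem tendsto_riemannSum_exp {z : ℂ} (hz : z ≠ 0) {T : ℝ} (hT : 0 < T) :
    Tendsto (fun m : ℕ => ∑ j ∈ Finset.range (m + 1),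
        ((T / (m + 1 : ℝ) : ℝ) : ℂ) * Complex.exp (((j * (T / (m + 1 : ℝ)) : ℝ) : ℂ) * z))
      atTop (𝓝 ((Complex.exp (T * z) - 1) / z)) := by
  have hδ : Tendsto (fun m : ℕ => T / (m + 1 : ℝ)) atTop (𝓝[≠] 0) := by
    refine tendsto_nhdsWithin_iff.2 ⟨?_, Eventually.of_forall fun m => ?_⟩
    · simpa [div_eq_mul_inv] using tendsto_one_div_add_atTop_nhds_zero_nat (𝕜 := ℝ) |>.const_mul T
    · exact (div_pos hT (by positivity)).ne'
  have hd : HasDerivAt (fun s : ℝ => Complex.exp ((s : ℂ) * z)) z 0 := by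
    have h1 : HasDerivAt (fun t : ℝ => (t : ℂ) * z) (1 * z) 0 :=
      (HasDerivAt.ofReal_comp (hasDerivAt_id (0 : ℝ))).mul_const z
    simpa using h1.cexp
  have hs := (hasDerivAt_iff_tendsto_slope.1 hd).comp hδ
  have hne := hs.eventually_ne hz
  refine Tendsto.congr' ?_ ((hs.inv₀ hz).const_mul (Complex.exp (T * z) - 1))
  filter_upwards [hne] with m hm
  simp only [Function.comp, slope, vsub_eq_sub, sub_zero, Complex.ofReal_zero, zero_mul,
    Complex.exp_zero, Complex.real_smul] at hm ⊢
  set δ : ℝ := T / (m + 1 : ℝ) with hδdef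
  have hm1 : (0 : ℝ) < m + 1 := by positivity
  have hδ0 : δ ≠ 0 := (div_pos hT hm1).ne'
  have hw : Complex.exp ((δ : ℂ) * z) ≠ 1 := fun h => hm (by simp [h])
  have hw' : Complex.exp ((δ : ℂ) * z) - 1 ≠ 0 := sub_ne_zero.2 hw
  have hpow : ∀ j : ℕ, Complex.exp (((j * δ : ℝ) : ℂ) * z) = Complex.exp ((δ : ℂ) * z) ^ j := by
    intro j
    rw [← Complex.exp_nat_mul]
    push_cast
    ring_nf
  have hTm : (T : ℂ) * z = (((m + 1 : ℕ) * δ : ℝ) : ℂ) * z := by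
    rw [hδdef]; push_cast
    field_simp
  have hδ0' : (δ : ℂ) ≠ 0 := by exact_mod_cast hδ0
  rw [hTm]
  simp only [hpow]
  rw [← Finset.mul_sum, geom_sum_eq hw]
  push_cast
  field_simp

/-- The Cesàro means of the powers of `w ≠ 1` with `‖w‖ ≤ 1` tend to zero. -/
theorem tendsto_cesaro_pow {w : ℂ} (hw : w ≠ 1) (hw1 : ‖w‖ ≤ 1) :
    Tendsto (fun N : ℕ => (N : ℂ)⁻¹ * ∑ j ∈ Finset.range N, w ^ j) atTop (𝓝 0) := by
  have h0 : Tendsto (fun N : ℕ => (N : ℝ)⁻¹ * (2 / ‖w - 1‖)) atTop (𝓝 0) := by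
    simpa using (tendsto_inv_atTop_nhds_zero_nat (𝕜 := ℝ)).mul_const (2 / ‖w - 1‖)
  refine squeeze_zero_norm (fun N => ?_) h0
  rw [geom_sum_eq hw, norm_mul, norm_inv, norm_div, Complex.norm_natCast]
  gcongr
  refine (norm_sub_le _ _).trans ?_
  rw [norm_pow, norm_one]
  linarith [pow_le_one₀ (n := N) (norm_nonneg w) hw1]

/-! ### Characteristic functions equal to one -/

/-- A law other than the point mass at zero has a characteristic function that differs from one
almost everywhere: where it equals one, `ξ * x ∈ 2πℤ` for almost every `x`, and for a fixed
`x ≠ 0` this happens for countably many `ξ` only. -/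
theorem ae_charFun_ne_one {μ : Measure ℝ} [IsProbabilityMeasure μ] (hμ : ¬ ∀ᵐ x ∂μ, x = 0) :
    ∀ᵐ ξ : ℝ, charFun μ ξ ≠ 1 := by
  have hSm : MeasurableSet {ξ : ℝ | charFun μ ξ = 1} :=
    (isClosed_singleton.preimage continuous_charFun).measurableSet
  have hint : ∀ ξ : ℝ, Integrable (fun x : ℝ => Complex.exp (ξ * x * Complex.I)) μ := fun ξ => by
    have hcont : Continuous fun x : ℝ => Complex.exp (ξ * x * Complex.I) := by fun_prop
    refine (integrable_const (1 : ℝ)).mono' hcont.aestronglyMeasurable ?_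
    refine ae_of_all _ fun x => ?_
    rw [Complex.norm_exp]; simp
  have h1 : ∀ ξ : ℝ, charFun μ ξ = 1 → ∀ᵐ x ∂μ, Real.cos (ξ * x) = 1 := by
    intro ξ hξ
    have hre : ∀ x : ℝ, (Complex.exp (ξ * x * Complex.I)).re = Real.cos (ξ * x) := fun x => by
      rw [← Complex.ofReal_mul, Complex.exp_ofReal_mul_I_re]
    have hc : Integrable (fun x => Real.cos (ξ * x)) μ := by
      have hcont : Continuous fun x => Real.cos (ξ * x) := by fun_prop
      exact (integrable_const (1 : ℝ)).mono' hcont.aestronglyMeasurable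
        (ae_of_all _ fun x => Real.abs_cos_le_one _)
    have hI : ∫ x, Real.cos (ξ * x) ∂μ = 1 := by
      have h := integral_re (hint ξ)
      rw [← charFun_apply_real, hξ] at h
      simpa [hre] using h
    have h0 : ∫ x, (1 - Real.cos (ξ * x)) ∂μ = 0 := by
      rw [integral_sub (integrable_const _) hc, hI]; simp
    rw [integral_eq_zero_iff_of_nonneg
      (fun x => sub_nonneg.2 (Real.cos_le_one _)) ((integrable_const _).sub hc)] at h0
    filter_upwards [h0] with x hx
    exact (sub_eq_zero.1 hx).symm
  have h2 : ∀ᵐ ξ ∂(volume.restrict {ξ : ℝ | charFun μ ξ = 1}), ∀ᵐ x ∂μ, Real.cos (ξ * x) = 1 :=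
    (ae_restrict_iff' hSm).2 (ae_of_all _ h1)
  have hm : MeasurableSet {p : ℝ × ℝ | Real.cos (p.1 * p.2) = 1} :=
    (isClosed_singleton.preimage
      (by fun_prop : Continuous fun p : ℝ × ℝ => Real.cos (p.1 * p.2))).measurableSet
  rw [Measure.ae_ae_comm hm] at h2
  -- some `x ≠ 0` satisfies `cos (ξ * x) = 1` for almost every `ξ` with `charFun μ ξ = 1`
  obtain ⟨x, hx, hx0⟩ := (h2.and_frequently (not_eventually.1 hμ)).exists
  have hcount : {ξ : ℝ | Real.cos (ξ * x) = 1}.Countable := by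
    refine (countable_range fun n : ℤ => n * (2 * Real.pi) / x).mono fun ξ hξ => ?_
    obtain ⟨n, hn⟩ := (Real.cos_eq_one_iff _).1 hξ
    exact ⟨n, by simp only [hn]; field_simp⟩
  filter_upwards [(ae_restrict_iff' hSm).1 hx, hcount.ae_notMem volume] with ξ h3 h4 h5
  exact h4 (h3 h5)

/-! ### Oscillation and time averages of the pairing -/

namespace IsConvSemigroup

variable {ν : ℝ≥0 → Measure ℝ} {η : ℝ → ℂ} {a : ℝ}

/-- The pairing of a solution of the Poisson equation moves by at most `2C` over any time span,
when `C` bounds `ĝ / η` on the support of the triangle function. The increment over `[0, T]` is a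
limit of Riemann sums for `∫ triangle(ξ) ĝ(ξ) ∫_0^T exp (s η(ξ)) ds dξ`, and the inner integral
equals `(exp (T η(ξ)) - 1) / η(ξ)`. -/
theorem abs_fejerPairing_sub_le (hν : IsConvSemigroup ν η) (ha : 0 < a) {H g : ℝ → ℝ} {M M' : ℝ}
    (hHm : Measurable H) (hM : ∀ x, |H x| ≤ M) (hgm : Measurable g) (hM' : ∀ x, |g x| ≤ M')
    (hg : Integrable g)
    (hgen : ∀ ε > 0, ∀ᶠ δ : ℝ≥0 in 𝓝[>] 0,
      ∀ x, |(δ : ℝ)⁻¹ * ((∫ y, H (x - y) ∂(ν δ)) - H x) - g x| ≤ ε)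
    (hη : ∀ᵐ ξ, η ξ ≠ 0) {C : ℝ} (hC : ∀ ξ, ξ ≠ 0 → |ξ| < a → ‖fourierHat g ξ / η ξ‖ ≤ C)
    {T : ℝ≥0} (hT : 0 < T) :
    |fejerPairing ν a H T - fejerPairing ν a H 0| ≤ 2 * C := by
  set Δ : ℝ := fejerPairing ν a H T - fejerPairing ν a H 0 with hΔ
  set δ : ℕ → ℝ≥0 := fun m => T / (m + 1) with hδdef
  have hδpos : ∀ m, 0 < δ m := fun m => div_pos hT (by positivity)
  have hδmul : ∀ m : ℕ, ((m + 1 : ℕ) : ℝ≥0) * δ m = T := fun m => by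
    simp only [hδdef]; push_cast; field_simp
  have hδcoe : ∀ m, (δ m : ℝ) = (T : ℝ) / (m + 1 : ℝ) := fun m => by simp [hδdef]
  have hδ0 : Tendsto δ atTop (𝓝[>] 0) := by
    refine tendsto_nhdsWithin_iff.2 ⟨?_, Eventually.of_forall hδpos⟩
    rw [← NNReal.tendsto_coe]
    simp only [hδcoe]
    simpa [div_eq_mul_inv] using
      tendsto_one_div_add_atTop_nhds_zero_nat (𝕜 := ℝ) |>.const_mul (T : ℝ)
  -- Riemann sums of the pairing with `g`, with `m + 1` steps of length `δ m`
  set S : ℕ → ℝ := fun m => ∑ j ∈ Finset.range (m + 1), δ m * fejerPairing ν a g (j * δ m)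
    with hS
  set A : ℝ := ∫ x, fejer a x
  have hA : 0 ≤ A := integral_nonneg (fejer_nonneg ha)
  have hSΔ : Tendsto S atTop (𝓝 Δ) := by
    rw [Metric.tendsto_nhds]
    intro ε hε
    filter_upwards [hδ0.eventually (hgen (ε / (T * A + 1)) (by positivity))] with m hm
    have h := hν.abs_fejerPairing_sub_sum_le ha hHm hM hgm hM' (hδpos m) hm (m + 1)
    rw [hδmul m, abs_sub_comm] at h
    rw [Real.dist_eq]
    refine h.trans_lt ?_
    have h1 : ((m + 1 : ℕ) : ℝ) * δ m = T := by exact_mod_cast congrArg NNReal.toReal (hδmul m)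
    rw [show ((m + 1 : ℕ) : ℝ) * ((δ m : ℝ) * (ε / (T * A + 1)) * A)
      = (((m + 1 : ℕ) : ℝ) * δ m) * A / (T * A + 1) * ε by ring, h1]
    refine mul_lt_of_lt_one_left hε ?_
    rw [div_lt_one (by positivity)]
    linarith
  set F : ℝ → ℂ := fun ξ =>
    (Complex.exp ((T : ℝ) * η ξ) - 1) / η ξ * (triangle a ξ * fourierHat g ξ) with hF
  set e : ℕ → ℝ → ℂ := fun m ξ => ∑ j ∈ Finset.range (m + 1),
    (δ m : ℂ) * Complex.exp ((((j * δ m : ℝ≥0) : ℝ) : ℂ) * η ξ) with he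
  have hSF : Tendsto (fun m => (S m : ℂ)) atTop (𝓝 (∫ ξ, F ξ)) := by
    have hi : ∀ m (j : ℕ), Integrable fun ξ => (δ m : ℂ) *
        (Complex.exp ((((j * δ m : ℝ≥0) : ℝ) : ℂ) * η ξ) * (triangle a ξ * fourierHat g ξ)) :=
      fun m j => (hν.integrable_exp_mul_triangle_mul a hg _).const_mul _
    have hsum : ∀ m, (fun ξ => e m ξ * (triangle a ξ * fourierHat g ξ)) = fun ξ =>
        ∑ j ∈ Finset.range (m + 1), (δ m : ℂ) *
          (Complex.exp ((((j * δ m : ℝ≥0) : ℝ) : ℂ) * η ξ) * (triangle a ξ * fourierHat g ξ)) := by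
      intro m
      funext ξ
      simp only [he, Finset.sum_mul, mul_assoc]
    have hSm : ∀ m, (S m : ℂ) = ∫ ξ, e m ξ * (triangle a ξ * fourierHat g ξ) := by
      intro m
      rw [hsum, integral_finsetSum _ fun j _ => hi m j]
      simp only [hS, Complex.ofReal_sum, Complex.ofReal_mul, integral_const_mul]
      exact Finset.sum_congr rfl fun j _ => by rw [hν.ofReal_fejerPairing a hg]
    simp only [hSm]
    have hk : Integrable fun ξ => (triangle a ξ : ℂ) * fourierHat g ξ :=
      (integrable_ofReal_triangle a).mul_bdd
        (continuous_fourierHat hg).aestronglyMeasurable (ae_of_all _ (norm_fourierHat_le g))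
    refine tendsto_integral_of_dominated_convergence
      (fun ξ => T * ‖(triangle a ξ : ℂ) * fourierHat g ξ‖) (fun m => ?_) (hk.norm.const_mul _)
      (fun m => ae_of_all _ fun ξ => ?_) ?_
    · rw [hsum]
      exact (integrable_finsetSum _ fun j _ => hi m j).aestronglyMeasurable
    · rw [norm_mul]
      refine mul_le_mul_of_nonneg_right ?_ (norm_nonneg _)
      have h1 : ∀ j ∈ Finset.range (m + 1),
          ‖(δ m : ℂ) * Complex.exp ((((j * δ m : ℝ≥0) : ℝ) : ℂ) * η ξ)‖ ≤ δ m := fun j _ => by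
        rw [norm_mul]
        have := hν.norm_exp_le_one (j * δ m) ξ
        have h2 : ‖((δ m : ℝ) : ℂ)‖ = δ m := by simp
        rw [h2]
        exact mul_le_of_le_one_right (δ m).2 this
      refine (norm_sum_le_of_le _ h1).trans_eq ?_
      rw [Finset.sum_const, Finset.card_range, nsmul_eq_mul]
      exact_mod_cast congrArg NNReal.toReal (hδmul m)
    · filter_upwards [hη] with ξ hξ
      refine Tendsto.mul_const _ ?_
      have := tendsto_riemannSum_exp hξ (T := T) hT
      simpa only [he, hδcoe, NNReal.coe_mul, NNReal.coe_natCast] using this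
  have hlim : (Δ : ℂ) = ∫ ξ, F ξ :=
    tendsto_nhds_unique ((Complex.continuous_ofReal.tendsto Δ).comp hSΔ) hSF
  have hbound : ‖∫ ξ, F ξ‖ ≤ ∫ ξ, triangle a ξ * (2 * C) := by
    refine norm_integral_le_of_norm_le ((integrable_triangle a).mul_const _) ?_
    filter_upwards [Measure.ae_ne volume (0 : ℝ)] with ξ hξ0
    rcases le_or_gt a |ξ| with h | h
    · simp [hF, triangle_eq_zero h]
    have h1 : F ξ = triangle a ξ * ((Complex.exp ((T : ℝ) * η ξ) - 1) *
        (fourierHat g ξ / η ξ)) := by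
      simp only [hF]; ring
    rw [h1, norm_mul, norm_mul, Complex.norm_real, Real.norm_of_nonneg (triangle_nonneg a ξ)]
    refine mul_le_mul_of_nonneg_left ?_ (triangle_nonneg a ξ)
    refine mul_le_mul ?_ (hC ξ hξ0 h) (norm_nonneg _) zero_le_two
    refine (norm_sub_le _ _).trans ?_
    have := hν.norm_exp_le_one T ξ
    rw [norm_one]
    linarith
  rw [← hlim, Complex.norm_real, Real.norm_eq_abs, integral_mul_const, integral_triangle ha,
    one_mul] at hbound
  exact hbound

/-- For an integrable function the time averages of the pairing along the multiples of `t` vanish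
in the limit: on the frequency side these are Cesàro means of powers of the characteristic function
of `ν t`. -/
theorem tendsto_average_fejerPairing_of_integrable (hν : IsConvSemigroup ν η) (a : ℝ)
    {h : ℝ → ℝ} (hh : Integrable h) {t : ℝ≥0} (ht : ∀ᵐ ξ, charFun (ν t) ξ ≠ 1) :
    Tendsto (fun N : ℕ => (N : ℝ)⁻¹ * ∑ j ∈ Finset.range N, fejerPairing ν a h (j * t)) atTop
      (𝓝 0) := by
  have := hν.prob t
  have hpow : ∀ (j : ℕ) (ξ : ℝ), Complex.exp ((((j * t : ℝ≥0) : ℝ) : ℂ) * η ξ)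
      = charFun (ν t) ξ ^ j := fun j ξ => by
    rw [hν.charFun_eq, ← Complex.exp_nat_mul]
    push_cast
    ring_nf
  have hk : Integrable fun ξ => (triangle a ξ : ℂ) * fourierHat h ξ :=
    (integrable_ofReal_triangle a).mul_bdd
      (continuous_fourierHat hh).aestronglyMeasurable (ae_of_all _ (norm_fourierHat_le h))
  have hi : ∀ j : ℕ, Integrable fun ξ =>
      charFun (ν t) ξ ^ j * (triangle a ξ * fourierHat h ξ) := fun j => by
    simpa only [hpow] using hν.integrable_exp_mul_triangle_mul a hh (j * t)
  have hlim : Tendsto (fun N : ℕ => ∫ ξ, ((N : ℂ)⁻¹ * ∑ j ∈ Finset.range N, charFun (ν t) ξ ^ j) *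
      (triangle a ξ * fourierHat h ξ)) atTop (𝓝 (∫ _ : ℝ, (0 : ℂ))) := by
    refine tendsto_integral_of_dominated_convergence
      (fun ξ => ‖(triangle a ξ : ℂ) * fourierHat h ξ‖) (fun N => ?_) hk.norm
      (fun N => ae_of_all _ fun ξ => ?_) ?_
    · refine AEStronglyMeasurable.mul (Continuous.aestronglyMeasurable ?_) hk.aestronglyMeasurable
      have : Continuous (charFun (ν t)) := continuous_charFun
      fun_prop
    · rw [norm_mul]
      refine mul_le_of_le_one_left (norm_nonneg _) ?_
      have h1 : ‖∑ j ∈ Finset.range N, charFun (ν t) ξ ^ j‖ ≤ N := by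
        refine (norm_sum_le_of_le _ fun j _ => ?_).trans_eq (b := ∑ _j ∈ Finset.range N, (1 : ℝ))
          (by simp)
        rw [norm_pow]
        exact pow_le_one₀ (norm_nonneg _) (norm_charFun_le_one ξ)
      rw [norm_mul, norm_inv, Complex.norm_natCast]
      exact inv_mul_le_one_of_le₀ h1 (Nat.cast_nonneg N)
    · filter_upwards [ht] with ξ hξ
      simpa using (tendsto_cesaro_pow hξ (norm_charFun_le_one ξ)).mul_const
        ((triangle a ξ : ℂ) * fourierHat h ξ)
  rw [integral_zero] at hlim
  have hre := (Complex.continuous_re.tendsto 0).comp hlim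
  refine hre.congr fun N => ?_
  rw [Function.comp, ← Complex.ofReal_re ((N : ℝ)⁻¹ * _)]
  congr 1
  simp only [mul_assoc, Finset.sum_mul, integral_const_mul]
  rw [integral_finsetSum _ fun j _ => hi j]
  push_cast
  congr 1
  refine Finset.sum_congr rfl fun j _ => ?_
  rw [hν.ofReal_fejerPairing a hh]
  push_cast [← hpow]
  rfl

/-- The same for functions vanishing at infinity, which are uniformly close to integrable ones. -/
theorem tendsto_average_fejerPairing (hν : IsConvSemigroup ν η) (ha : 0 < a) (H : C₀(ℝ, ℝ))
    {t : ℝ≥0} (ht : ∀ᵐ ξ, charFun (ν t) ξ ≠ 1) :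
    Tendsto (fun N : ℕ => (N : ℝ)⁻¹ * ∑ j ∈ Finset.range N, fejerPairing ν a H (j * t)) atTop
      (𝓝 0) := by
  have hHc : Continuous H := H.continuous
  set A : ℝ := ∫ x, fejer a x
  have hA : 0 ≤ A := integral_nonneg (fejer_nonneg ha)
  rw [Metric.tendsto_nhds]
  intro ε hε
  set ε' : ℝ := ε / 2 / (A + 1) with hε'
  have hε'0 : 0 < ε' := by positivity
  obtain ⟨K, hK, hKH⟩ : ∃ K : Set ℝ, IsCompact K ∧ ∀ x ∉ K, |H x| ≤ ε' := by
    have h := H.zero_at_infty' (Metric.closedBall_mem_nhds 0 hε'0)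
    obtain ⟨K, hK, hsub⟩ := mem_cocompact.1 h
    refine ⟨K, hK, fun x hx => ?_⟩
    simpa using hsub hx
  set h : ℝ → ℝ := K.indicator H with hhdef
  have hh : Integrable h :=
    (integrable_indicator_iff hK.measurableSet).2 (hHc.continuousOn.integrableOn_compact hK)
  have hhm : Measurable h := hHc.measurable.indicator hK.measurableSet
  have hM : ∀ x, |H x| ≤ ‖H‖ := fun x => H.toBCF.norm_coe_le_norm x
  have hhM : ∀ x, |h x| ≤ ‖H‖ := fun x => (norm_indicator_le_norm_self H x).trans (hM x)
  have hdiff : ∀ x, |H x - h x| ≤ ε' := fun x => by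
    by_cases hx : x ∈ K
    · simp [hhdef, hx, hε'0.le]
    · simpa [hhdef, hx] using hKH x hx
  have hsub : ∀ s, |fejerPairing ν a H s - fejerPairing ν a h s| ≤ ε' * A := fun s => by
    have := hν.abs_integral_mul_shiftMean_le ha hdiff s
    simp only [sub_mul] at this
    rwa [integral_sub (hν.integrable_mul_shiftMean ha hHc.measurable hM s)
      (hν.integrable_mul_shiftMean ha hhm hhM s)] at this
  have hlim := hν.tendsto_average_fejerPairing_of_integrable a hh ht
  filter_upwards [(Metric.tendsto_nhds.1 hlim) (ε / 2) (by positivity)] with N hN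
  rw [Real.dist_0_eq_abs] at hN ⊢
  have h1 : |(N : ℝ)⁻¹ * ∑ j ∈ Finset.range N, fejerPairing ν a H (j * t)
      - (N : ℝ)⁻¹ * ∑ j ∈ Finset.range N, fejerPairing ν a h (j * t)| ≤ ε' * A := by
    rw [← mul_sub, ← Finset.sum_sub_distrib, abs_mul, abs_inv, Nat.abs_cast]
    have h2 : |∑ j ∈ Finset.range N, (fejerPairing ν a H (j * t) - fejerPairing ν a h (j * t))|
        ≤ N * (ε' * A) := by
      refine (Finset.abs_sum_le_sum_abs _ _).trans ?_
      refine (Finset.sum_le_card_nsmul (Finset.range N) _ _ fun j _ => hsub (j * t)).trans_eq ?_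
      simp
    refine inv_mul_le_of_le_mul₀ (Nat.cast_nonneg N) (by positivity) h2
  have h3 : ε' * A < ε / 2 := by
    rw [hε', div_mul_eq_mul_div, div_lt_iff₀ (by positivity)]
    nlinarith
  have := abs_le.1 h1
  have := abs_lt.1 hN
  rw [abs_lt]
  constructor <;> linarith

end IsConvSemigroup

/-! ### The Poisson equation of a Lévy process -/

theorem IsLevyProcess.isConvSemigroup {Ω : Type*} [MeasurableSpace Ω] {L : ℝ≥0 → Ω → ℝ}
    {P : Measure Ω} [IsProbabilityMeasure P] (hL : IsLevyProcess L P) :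
    IsConvSemigroup (fun t => P.map (L t)) (charExponent L P) where
  prob t := Measure.isProbabilityMeasure_map (hL.measurable t).aemeasurable
  charFun_eq := hL.charFun_eq

/-- The transition operators of the dual process in terms of the laws of the process. -/
theorem transitionOp_dualProcess {Ω : Type*} [MeasurableSpace Ω] {L : ℝ≥0 → Ω → ℝ}
    {P : Measure Ω} (hL : IsLevyProcess L P) (t : ℝ≥0) (f : C₀(ℝ, ℝ)) (x : ℝ) :
    transitionOp (dualProcess L) P t f x = ∫ y, f (x - y) ∂(P.map (L t)) := by
  have hc : Continuous fun y => f (x - y) := f.continuous.comp (continuous_const.sub continuous_id)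
  rw [integral_map (hL.measurable t).aemeasurable hc.aestronglyMeasurable]
  simp only [transitionOp, dualProcess, neg_add_eq_sub]

theorem mainTheorem6 {Ω : Type*} [MeasurableSpace Ω] (P : Measure Ω) [IsProbabilityMeasure P]
    (L : ℝ≥0 → Ω → ℝ) (hL : IsLevyProcess L P)
    (hL_nonconst : ¬ ∀ t : ℝ≥0, ∀ᵐ ω ∂P, L t ω = 0)
    (g : C₀(ℝ, ℝ)) (hg : Integrable g volume)
    (hquot : QuotientLocallyBoundedAtZero (fourierHat g) (charExponent L P))
    (H : C₀(ℝ, ℝ)) (hH : SolvesPoisson L P H g) (hH_nonneg : ∀ x : ℝ, 0 ≤ H x) :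
    Integrable H volume := by
  obtain ⟨a₀, ha₀, C, hC⟩ := hquot
  have hν := hL.isConvSemigroup
  have hHc : Continuous H := H.continuous
  have hHM : ∀ x, |H x| ≤ ‖H‖ := fun x => H.toBCF.norm_coe_le_norm x
  have hgM : ∀ x, |g x| ≤ ‖g‖ := fun x => g.toBCF.norm_coe_le_norm x
  obtain ⟨t, ht⟩ := not_forall.1 hL_nonconst
  have hprob := hν.prob t
  have ht1 : ∀ᵐ ξ, charFun (P.map (L t)) ξ ≠ 1 := by
    refine ae_charFun_ne_one fun h => ht ?_
    exact ae_of_ae_map (hL.measurable t).aemeasurable h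
  have ht0 : 0 < t := by
    refine pos_iff_ne_zero.2 fun h => ht ?_
    rw [h]
    exact hL.start_zero
  have hη : ∀ᵐ ξ, charExponent L P ξ ≠ 0 := by
    filter_upwards [ht1] with ξ hξ h
    exact hξ (by rw [hL.charFun_eq, h, mul_zero, Complex.exp_zero])
  have hgen : ∀ ε > 0, ∀ᶠ δ : ℝ≥0 in 𝓝[>] 0,
      ∀ x, |(δ : ℝ)⁻¹ * ((∫ y, H (x - y) ∂(P.map (L δ))) - H x) - g x| ≤ ε := by
    intro ε hε
    filter_upwards [Metric.tendstoUniformly_iff.1 hH ε hε] with δ hδ x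
    have h := hδ x
    rw [dist_comm, Real.dist_eq, transitionOp_dualProcess hL] at h
    exact h.le
  have hC0 : 0 ≤ C :=
    (norm_nonneg _).trans (hC (a₀ / 2) (by positivity) (by rw [abs_of_pos] <;> linarith))
  -- the pairing at time zero is bounded by the size of its oscillation, as its averages vanish
  have hpair : ∀ a, 0 < a → a ≤ a₀ → ∫ x, H x * fejer a x ≤ 2 * C := by
    intro a ha haa
    have h0 : fejerPairing (fun t => P.map (L t)) a H 0 = ∫ x, H x * fejer a x := by
      rw [fejerPairing, hν.shiftMean_zero]
    rw [← h0]
    have hosc : ∀ j : ℕ, fejerPairing (fun t => P.map (L t)) a H 0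
        ≤ fejerPairing (fun t => P.map (L t)) a H (j * t) + 2 * C := by
      intro j
      rcases Nat.eq_zero_or_pos j with rfl | hj
      · rw [Nat.cast_zero, zero_mul]; linarith
      have h := hν.abs_fejerPairing_sub_le ha hHc.measurable hHM g.continuous.measurable hgM hg
        hgen hη (fun ξ h1 h2 => hC ξ h1 (h2.trans_le haa)) (T := j * t) (by positivity)
      have := (abs_le.1 h).1
      linarith
    have hlim := (hν.tendsto_average_fejerPairing ha H ht1).add_const (2 * C)
    rw [zero_add] at hlim
    refine ge_of_tendsto hlim ?_
    filter_upwards [eventually_gt_atTop 0] with N hN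
    have hN' : (0 : ℝ) < N := by exact_mod_cast hN
    have h := Finset.sum_le_sum fun j (_ : j ∈ Finset.range N) => hosc j
    rw [Finset.sum_add_distrib, Finset.sum_const, Finset.sum_const, Finset.card_range,
      nsmul_eq_mul, nsmul_eq_mul] at h
    rw [← mul_le_mul_iff_right₀ hN', mul_add, mul_inv_cancel_left₀ hN'.ne']
    exact h
  -- the Fejér kernel is bounded below on `[-1 / a, 1 / a]`
  refine integrable_of_intervalIntegral_norm_bounded (l := atTop)
    (a := fun r : ℝ => -r) (b := fun r => r) (2 * C * (Real.pi ^ 2 / 4))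
    (fun r => (hHc.continuousOn.integrableOn_compact isCompact_Icc).mono_set Ioc_subset_Icc_self)
    tendsto_neg_atTop_atBot tendsto_id ?_
  filter_upwards [eventually_gt_atTop 0, eventually_ge_atTop (1 / a₀)] with r hr hra
  have ha : 0 < 1 / r := by positivity
  have haa : 1 / r ≤ a₀ := by
    rw [div_le_iff₀ hr, mul_comm, ← div_le_iff₀ ha₀]; exact hra
  have hi : Integrable fun x => H x * fejer (1 / r) x :=
    (integrable_fejer ha).bdd_mul hHc.aestronglyMeasurable (ae_of_all _ hHM)
  have h1 : ∫ x in (-r)..r, ‖H x‖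
      ≤ ∫ x in Ioc (-r) r, H x * fejer (1 / r) x * (Real.pi ^ 2 / 4) := by
    rw [intervalIntegral.integral_of_le (by linarith)]
    refine setIntegral_mono_on ?_ (hi.mul_const _).integrableOn measurableSet_Ioc fun x hx => ?_
    · exact (hHc.norm.continuousOn.integrableOn_compact isCompact_Icc).mono_set
        Ioc_subset_Icc_self
    · have h2 : 4 / Real.pi ^ 2 ≤ fejer (1 / r) x := by
        refine le_fejer ha ?_
        rw [abs_mul, abs_of_pos ha, one_div_mul_eq_div, div_le_one hr, abs_le]
        exact ⟨hx.1.le, hx.2⟩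
      have h3 : 1 ≤ fejer (1 / r) x * (Real.pi ^ 2 / 4) := by
        rw [div_le_iff₀ (by positivity)] at h2
        linarith
      rw [Real.norm_of_nonneg (hH_nonneg x), mul_assoc]
      exact le_mul_of_one_le_right (hH_nonneg x) h3
  refine h1.trans ?_
  rw [integral_mul_const]
  refine mul_le_mul_of_nonneg_right ?_ (by positivity)
  refine le_trans ?_ (hpair _ ha haa)
  exact setIntegral_le_integral hi
    (ae_of_all _ fun x => mul_nonneg (hH_nonneg x) (fejer_nonneg ha x))
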